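/- Let $\mathcal L=\{<,E\}$ be the first-order language with two binary relation symbols. A convex linear order is an $\mathcal L$-structure in which $<$ is a (strict) linear order, $E$ is an equivalence relation, and every $E$-class is an interval for $<$ (if $x\mathrel{E}y$ and $x<z<y$, then $z\mathrel{E}x$ and $z\mathrel{E}y$). Convex linear orders admit both a labeled and an unlabeled first-order logical limit law, and the two coincide. That is: for a first-order $\mathcal L$-sentence $\varphi$ and $n\in\mathbb N$, let $P_n(\varphi)$ be the proportion of those convex linear orders with universe a fixed $n$-element set (such as $\{1,\dots,n\}$) that satisfy $\varphi$, and let $Q_n(\varphi)$ be the proportion of those isomorphism classes of convex linear orders with $n$ points whose members satisfy $\varphi$. Then (i) a finite convex linear order has no automorphism other than the identity; (ii) $P_n(\varphi)=Q_n(\varphi)$ for all $\varphi$ and all $n$; (iii) for every $\varphi$, the limit $\lim_{n\to\infty}P_n(\varphi)=\lim_{n\to\infty}Q_n(\varphi)$ exists. -/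

import Mathlib

open FirstOrder FirstOrder.Language Filter Topology

/-- The relation symbols `<` and `E`, both binary. -/
inductive ConvexOrderRel : ℕ → Type
  | lt : ConvexOrderRel 2
  | eqv : ConvexOrderRel 2

/-- The first-order language `{<, E}` (equality is always available as a logical symbol). -/
def convexOrderLang : FirstOrder.Language := ⟨fun _ => Empty, ConvexOrderRel⟩

/-- The interpretation of `<` in a `{<, E}`-structure. -/
def StrLT (M : Type*) [convexOrderLang.Structure M] (x y : M) : Prop :=
  Structure.RelMap (L := convexOrderLang) ConvexOrderRel.lt ![x, y]

/-- The interpretation of `E` in a `{<, E}`-structure. -/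
def StrE (M : Type*) [convexOrderLang.Structure M] (x y : M) : Prop :=
  Structure.RelMap (L := convexOrderLang) ConvexOrderRel.eqv ![x, y]

/-- A convex linear order: `<` is a strict total order, `E` is an equivalence relation, and every
`E`-class is an interval for `<`. -/
structure IsConvexLinearOrder (M : Type*) [convexOrderLang.Structure M] : Prop where
  irrefl : ∀ x : M, ¬ StrLT M x x
  trans : ∀ x y z : M, StrLT M x y → StrLT M y z → StrLT M x z
  total : ∀ x y : M, StrLT M x y ∨ x = y ∨ StrLT M y x
  equivalence : Equivalence (StrE M)
  convex : ∀ x y z : M, StrE M x y → StrLT M x z → StrLT M z y → StrE M x z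

/-- The labeled convex linear orders of size `n`: all convex linear orders on the universe
`Fin n`. -/
def LabeledCLO (n : ℕ) : Type :=
  {S : convexOrderLang.Structure (Fin n) // @IsConvexLinearOrder (Fin n) S}

/-- The isomorphisms between two labeled convex linear orders of size `n`. -/
abbrev LabeledCLO.Iso {n : ℕ} (S T : LabeledCLO n) : Type :=
  @FirstOrder.Language.Equiv convexOrderLang (Fin n) (Fin n) S.1 T.1

/-- The underlying map on points of an isomorphism. -/
def LabeledCLO.Iso.map {n : ℕ} {S T : LabeledCLO n} (f : S.Iso T) (x : Fin n) : Fin n :=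
  (@FirstOrder.Language.Equiv.toEquiv convexOrderLang (Fin n) (Fin n) S.1 T.1 f) x

/-- The convex linear order `S` satisfies the sentence `φ`. -/
def LabeledCLO.Sat {n : ℕ} (S : LabeledCLO n) (φ : convexOrderLang.Sentence) : Prop :=
  @Sentence.Realize convexOrderLang (Fin n) S.1 φ

/-- The isomorphism relation on labeled convex linear orders of size `n`. -/
instance LabeledCLO.isoSetoid (n : ℕ) : Setoid (LabeledCLO n) where
  r S T := Nonempty (S.Iso T)
  iseqv := by
    refine ⟨fun S => ?_, fun {S T} h => ?_, fun {S T U} h k => ?_⟩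
    · let := S.1
      exact ⟨FirstOrder.Language.Equiv.refl convexOrderLang (Fin n)⟩
    · obtain ⟨f⟩ := h
      exact ⟨@FirstOrder.Language.Equiv.symm convexOrderLang (Fin n) (Fin n) S.1 T.1 f⟩
    · obtain ⟨f⟩ := h
      obtain ⟨g⟩ := k
      exact ⟨@FirstOrder.Language.Equiv.comp convexOrderLang (Fin n) (Fin n) S.1 T.1
        (Fin n) U.1 g f⟩

/-- The unlabeled convex linear orders of size `n`: isomorphism classes of convex linear orders
with `n` points. -/
def UnlabeledCLO (n : ℕ) : Type := Quotient (LabeledCLO.isoSetoid n)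

theorem LabeledCLO.sat_of_iso {n : ℕ} {S T : LabeledCLO n} (f : S.Iso T)
    (φ : convexOrderLang.Sentence) : S.Sat φ ↔ T.Sat φ :=
  @StrongHomClass.realize_sentence convexOrderLang (Fin n) (Fin n) S.1 T.1 (S.Iso T)
    (@FirstOrder.Language.Equiv.instEquivLike convexOrderLang (Fin n) (Fin n) S.1 T.1)
    (@FirstOrder.Language.Equiv.instStrongHomClass convexOrderLang (Fin n) (Fin n) S.1 T.1) f φ

/-- The isomorphism class `C` satisfies the sentence `φ`, that is, its members do. -/
def UnlabeledCLO.Sat {n : ℕ} (C : UnlabeledCLO n) (φ : convexOrderLang.Sentence) : Prop :=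
  Quotient.lift (fun S : LabeledCLO n => S.Sat φ)
    (fun S T (h : Nonempty (S.Iso T)) => propext (h.elim fun f => LabeledCLO.sat_of_iso f φ)) C

/-- There are only finitely many labeled convex linear orders of size `n`. -/
instance LabeledCLO.instFinite (n : ℕ) : Finite (LabeledCLO n) := by
  let F : LabeledCLO n → (Fin n → Fin n → Prop) × (Fin n → Fin n → Prop) :=
    fun S => (@StrLT (Fin n) S.1, @StrE (Fin n) S.1)
  refine Finite.of_injective F ?_
  rintro ⟨S, hS⟩ ⟨T, hT⟩ h
  have h1 : @StrLT (Fin n) S = @StrLT (Fin n) T := congrArg Prod.fst h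
  have h2 : @StrE (Fin n) S = @StrE (Fin n) T := congrArg Prod.snd h
  apply Subtype.ext
  apply FirstOrder.Language.Structure.ext
  · funext m f
    exact f.elim
  · funext m r v
    have hv : ∀ v : Fin 2 → Fin n, v = ![v 0, v 1] := fun v => by
      ext i; fin_cases i <;> rfl
    cases r with
    | lt =>
      rw [hv v]
      exact congrFun (congrFun h1 (v 0)) (v 1)
    | eqv =>
      rw [hv v]
      exact congrFun (congrFun h2 (v 0)) (v 1)

/-- There is a labeled convex linear order of every size `n`. -/
instance LabeledCLO.instNonempty (n : ℕ) : Nonempty (LabeledCLO n) := by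
  let S : convexOrderLang.Structure (Fin n) :=
    { funMap := fun f => f.elim
      RelMap := fun r => match r with
        | .lt => fun v => v 0 < v 1
        | .eqv => fun v => v 0 = v 1 }
  exact ⟨⟨S, @IsConvexLinearOrder.mk (Fin n) S
    (fun x => lt_irrefl x)
    (fun x y z (h : x < y) (k : y < z) => lt_trans h k)
    (fun x y => lt_trichotomy x y)
    ⟨fun x => rfl, fun {x y} (h : x = y) => h.symm,
      fun {x y z} (h : x = y) (k : y = z) => h.trans k⟩
    (fun x y z (h : x = y) (k : x < z) (l : z < y) => absurd (h ▸ k) (lt_asymm l))⟩⟩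

instance UnlabeledCLO.instFinite (n : ℕ) : Finite (UnlabeledCLO n) :=
  inferInstanceAs (Finite (Quotient (LabeledCLO.isoSetoid n)))

instance UnlabeledCLO.instNonempty (n : ℕ) : Nonempty (UnlabeledCLO n) :=
  (LabeledCLO.instNonempty n).map (Quotient.mk (LabeledCLO.isoSetoid n))

/-- The probability that a uniformly random labeled convex linear order of size `n` satisfies
`φ`. -/
noncomputable def labeledProb (φ : convexOrderLang.Sentence) (n : ℕ) : ℝ :=
  (Nat.card {S : LabeledCLO n // S.Sat φ} : ℝ) / (Nat.card (LabeledCLO n) : ℝ)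

/-- The probability that a uniformly random unlabeled convex linear order of size `n` satisfies
`φ`. -/
noncomputable def unlabeledProb (φ : convexOrderLang.Sentence) (n : ℕ) : ℝ :=
  (Nat.card {C : UnlabeledCLO n // C.Sat φ} : ℝ) / (Nat.card (UnlabeledCLO n) : ℝ)

/-! Up to isomorphism, a convex linear order on `m + 1` points is a binary word of length `m`: sort
the points and mark each one, other than the first, that starts a new class (`cutsEquiv`).
Isomorphisms between finite linear orders are unique, so every isomorphism class has exactly `n!`
labelings. This gives rigidity and equality of the two probabilities, and leaves a question about
uniformly random binary words.

Truth of a sentence depends only on the rank `q` type of the word for some `q`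
(`exists_realize_sentence_iff_of_wordType_eq`). This is the Ehrenfeucht–Fraïssé argument: choosing a
letter splits a word into two sides that can then be treated independently. Rank `q` types over a
finite alphabet form a finite aperiodic monoid, so some word `u` satisfies `u x u ~ u` for all `x`
(`exists_absorbing_word`).

A long random word very likely contains `u` both near its start and near its end, and then its
middle does not affect the type. Lengthening the middle thus barely changes the probability, so the
probabilities form a Cauchy sequence (`exists_tendsto_wordAvg`). -/

/-! ### Types of words and the finite aperiodic monoid they form -/

/-- The possible types of rank `q` of words over the alphabet `α`. -/
def WordType (α : Type) : ℕ → Type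
  | 0 => Unit
  | q + 1 => Set (WordType α q × α × WordType α q)

/-- The type of rank `q` of a word: at rank `q + 1` it lists the rank `q` types of the two sides of
every letter, together with that letter. -/
def wordType {α : Type} : (q : ℕ) → List α → WordType α q
  | 0, _ => ()
  | q + 1, w => {t : WordType α q × α × WordType α q |
      ∃ x a y, w = x ++ a :: y ∧ t = (wordType q x, a, wordType q y)}

section WordType

variable {α β : Type}

instance WordType.instFinite [Finite α] (q : ℕ) : Finite (WordType α q) := by
  induction q with
  | zero => exact inferInstanceAs (Finite Unit)
  | succ q ih => exact inferInstanceAs (Finite (Set (WordType α q × α × WordType α q)))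

theorem exists_split_of_wordType_eq {q : ℕ} {w w' : List α}
    (h : wordType (q + 1) w = wordType (q + 1) w') {x y : List α} {a : α} (hw : w = x ++ a :: y) :
    ∃ x' y', w' = x' ++ a :: y' ∧ wordType q x = wordType q x' ∧ wordType q y = wordType q y' := by
  have h' := Set.ext_iff.1 h (wordType q x, a, wordType q y)
  obtain ⟨x', a', y', e, e'⟩ := h'.1 ⟨x, a, y, hw, rfl⟩
  simp only [Prod.mk.injEq] at e'
  obtain ⟨e1, rfl, e3⟩ := e'
  exact ⟨x', y', e, e1, e3⟩

theorem wordType_succ_eq {q : ℕ} {w w' : List α}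
    (h : ∀ x a y, w = x ++ a :: y → ∃ x' y', w' = x' ++ a :: y' ∧
      wordType q x = wordType q x' ∧ wordType q y = wordType q y')
    (h' : ∀ x a y, w' = x ++ a :: y → ∃ x' y', w = x' ++ a :: y' ∧
      wordType q x = wordType q x' ∧ wordType q y = wordType q y') :
    wordType (q + 1) w = wordType (q + 1) w' := by
  refine Set.ext fun t => ⟨?_, ?_⟩
  · rintro ⟨x, a, y, e, rfl⟩
    obtain ⟨x', y', e', h1, h2⟩ := h x a y e
    exact ⟨x', a, y', e', by rw [h1, h2]⟩
  · rintro ⟨x, a, y, e, rfl⟩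
    obtain ⟨x', y', e', h1, h2⟩ := h' x a y e
    exact ⟨x', a, y', e', by rw [h1, h2]⟩

theorem wordType_eq_of_succ {q : ℕ} : ∀ {w w' : List α},
    wordType (q + 1) w = wordType (q + 1) w' → wordType q w = wordType q w' := by
  induction q with
  | zero => intros; rfl
  | succ q ih =>
    intro w w' h
    refine wordType_succ_eq (fun x a y e => ?_) (fun x a y e => ?_)
    · obtain ⟨x', y', e', h1, h2⟩ := exists_split_of_wordType_eq h e
      exact ⟨x', y', e', ih h1, ih h2⟩
    · obtain ⟨x', y', e', h1, h2⟩ := exists_split_of_wordType_eq h.symm e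
      exact ⟨x', y', e', ih h1, ih h2⟩

theorem wordType_eq_of_le {q r : ℕ} (hqr : q ≤ r) {w w' : List α}
    (h : wordType r w = wordType r w') : wordType q w = wordType q w' := by
  induction r, hqr using Nat.le_induction with
  | base => exact h
  | succ r _ ih => exact ih (wordType_eq_of_succ h)

/-- A letter chosen in a concatenation lies in one factor. It is answered in the matching factor,
while the other factor only loses a rank. This makes type equality a congruence. -/
theorem wordType_append {q : ℕ} : ∀ {u u' v v' : List α}, wordType q u = wordType q u' →
    wordType q v = wordType q v' → wordType q (u ++ v) = wordType q (u' ++ v') := by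
  induction q with
  | zero => intros; rfl
  | succ q ih =>
    have key : ∀ {u u' v v' : List α}, wordType (q + 1) u = wordType (q + 1) u' →
        wordType (q + 1) v = wordType (q + 1) v' → ∀ x a y, u ++ v = x ++ a :: y →
        ∃ x' y', u' ++ v' = x' ++ a :: y' ∧
          wordType q x = wordType q x' ∧ wordType q y = wordType q y' := by
      intro u u' v v' hu hv x a y e
      rcases List.append_eq_append_iff.1 e with ⟨z, rfl, rfl⟩ | ⟨z, hz, hz'⟩
      · obtain ⟨x', y', rfl, h1, h2⟩ := exists_split_of_wordType_eq hv rfl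
        exact ⟨u' ++ x', y', by simp, ih (wordType_eq_of_succ hu) h1, h2⟩
      · cases z with
        -- Here the chosen letter is the head of `v`, so it is answered in `v'` with an empty left
        -- side.
        | nil =>
          obtain ⟨x', y', rfl, h1, h2⟩ := exists_split_of_wordType_eq (x := []) hv hz'.symm
          refine ⟨u' ++ x', y', by simp, ?_, h2⟩
          simpa [hz] using ih (wordType_eq_of_succ hu) h1
        | cons b z =>
          simp only [List.cons_append, List.cons.injEq] at hz'
          obtain ⟨rfl, rfl⟩ := hz'
          obtain ⟨x', y', rfl, h1, h2⟩ := exists_split_of_wordType_eq hu hz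
          exact ⟨x', y' ++ v', by simp, h1, ih h2 (wordType_eq_of_succ hv)⟩
    intro u u' v v' hu hv
    exact wordType_succ_eq (key hu hv) (key hu.symm hv.symm)

theorem wordType_map (f : α → β) {q : ℕ} : ∀ {w w' : List α}, wordType q w = wordType q w' →
    wordType q (w.map f) = wordType q (w'.map f) := by
  induction q with
  | zero => intros; rfl
  | succ q ih =>
    have key : ∀ {w w' : List α}, wordType (q + 1) w = wordType (q + 1) w' →
        ∀ x a y, w.map f = x ++ a :: y → ∃ x' y', w'.map f = x' ++ a :: y' ∧
          wordType q x = wordType q x' ∧ wordType q y = wordType q y' := by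
      intro w w' h x a y e
      obtain ⟨x, z, rfl, rfl, hz⟩ := List.map_eq_append_iff.1 e
      obtain ⟨a, y, rfl, rfl, rfl⟩ := List.map_eq_cons_iff.1 hz
      obtain ⟨x', y', rfl, h1, h2⟩ := exists_split_of_wordType_eq h rfl
      exact ⟨x'.map f, y'.map f, by simp, ih h1, ih h2⟩
    intro w w' h
    exact wordType_succ_eq (key h) (key h.symm)

/-- The congruence of having the same type of rank `q`. -/
def wordTypeCon (α : Type) (q : ℕ) : Con (FreeMonoid α) where
  r u v := wordType q u.toList = wordType q v.toList
  iseqv := ⟨fun _ => rfl, fun h => h.symm, fun h k => h.trans k⟩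
  mul' h k := by simpa using wordType_append h k

theorem split_pow (v : FreeMonoid α) (m : ℕ) : ∀ {x y : List α} {a : α},
    (v ^ m).toList = x ++ a :: y → ∃ (i j : ℕ) (x₀ y₀ : List α), i + j + 1 = m ∧
      v.toList = x₀ ++ a :: y₀ ∧ x = (v ^ i).toList ++ x₀ ∧ y = y₀ ++ (v ^ j).toList := by
  induction m with
  | zero => intro x y a e; simp at e
  | succ m ih =>
    intro x y a e
    rw [pow_succ', FreeMonoid.toList_mul] at e
    rcases List.append_eq_append_iff.1 e with ⟨z, rfl, hz⟩ | ⟨z, hz, hz'⟩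
    · obtain ⟨i, j, x₀, y₀, rfl, h1, rfl, rfl⟩ := ih hz
      exact ⟨i + 1, j, x₀, y₀, by omega, h1, by simp [pow_succ'], rfl⟩
    · cases z with
      | nil =>
        obtain ⟨i, j, x₀, y₀, rfl, h1, h2, rfl⟩ := ih (x := []) hz'.symm
        refine ⟨i + 1, j, x₀, y₀, by omega, h1, ?_, rfl⟩
        rw [pow_succ', FreeMonoid.toList_mul, List.append_assoc, ← h2]
        simpa using hz.symm
      | cons b z =>
        simp only [List.cons_append, List.cons.injEq] at hz'
        obtain ⟨rfl, rfl⟩ := hz'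
        exact ⟨0, m, x, z, by omega, hz, by simp, rfl⟩

/-- Aperiodicity: rank `q` cannot tell exponents from `2 ^ q - 1` on apart. A chosen letter uses up
one copy of `v` and leaves exponents with `i + j + 1 = m`. An exponent below the threshold is copied
exactly, and one above it need only stay above it. -/
theorem wordType_pow (v : FreeMonoid α) (q : ℕ) : ∀ {m m' : ℕ}, 2 ^ q ≤ m + 1 → 2 ^ q ≤ m' + 1 →
    wordType q (v ^ m).toList = wordType q (v ^ m').toList := by
  induction q with
  | zero => intros; rfl
  | succ q ih =>
    have key : ∀ {m m' : ℕ}, 2 ^ (q + 1) ≤ m + 1 → 2 ^ (q + 1) ≤ m' + 1 →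
        ∀ x a y, (v ^ m).toList = x ++ a :: y → ∃ x' y', (v ^ m').toList = x' ++ a :: y' ∧
          wordType q x = wordType q x' ∧ wordType q y = wordType q y' := by
      intro m m' hm hm' x a y e
      obtain ⟨i, j, x₀, y₀, rfl, h1, rfl, rfl⟩ := split_pow v m e
      have hq : 0 < 2 ^ q := by positivity
      obtain ⟨i', j', e', hi, hj⟩ : ∃ i' j', i' + j' + 1 = m' ∧
          wordType q (v ^ i).toList = wordType q (v ^ i').toList ∧
          wordType q (v ^ j).toList = wordType q (v ^ j').toList := by
        by_cases hi : i + 1 < 2 ^ q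
        · exact ⟨i, m' - 1 - i, by omega, rfl, ih (by omega) (by omega)⟩
        · by_cases hj : j + 1 < 2 ^ q
          · exact ⟨m' - 1 - j, j, by omega, ih (by omega) (by omega), rfl⟩
          · exact ⟨2 ^ q - 1, m' - 2 ^ q, by omega, ih (by omega) (by omega),
              ih (by omega) (by omega)⟩
      refine ⟨(v ^ i').toList ++ x₀, y₀ ++ (v ^ j').toList, ?_, wordType_append hi rfl,
        wordType_append rfl hj⟩
      rw [← e', add_assoc, pow_add, pow_succ', FreeMonoid.toList_mul,
        FreeMonoid.toList_mul, h1]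
      simp
    intro m m' hm hm'
    exact wordType_succ_eq (key hm hm') (key hm' hm)

/-- In a finite aperiodic monoid, the product of all elements absorbs whatever stands between two of
its occurrences. -/
theorem exists_mul_mul_self_eq_self {M : Type*} [Monoid M] [Finite M] {N : ℕ}
    (hM : ∀ x : M, x ^ (N + 1) = x ^ N) : ∃ u : M, ∀ x, u * x * u = u := by
  have := Fintype.ofFinite M
  refine ⟨(Finset.univ : Finset M).toList.prod, fun x => ?_⟩
  set u := (Finset.univ : Finset M).toList.prod with hu
  -- The element `u * x * u` is itself one of the factors of the product `u`.
  obtain ⟨a, b, h⟩ : ∃ a b, u = a * (u * x * u) * b := by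
    have hm : u * x * u ∈ (Finset.univ : Finset M).toList := by simp
    obtain ⟨s, t, e⟩ := List.append_of_mem hm
    refine ⟨s.prod, t.prod, ?_⟩
    conv_lhs => rw [hu, e]
    simp [mul_assoc]
  -- Iterating gives `u = c ^ N * u * d ^ N`, where aperiodicity lets one further `c` or `d` be
  -- absorbed.
  have iter : ∀ c d : M, u = c * u * d → c * u = u ∧ u * d = u := by
    intro c d e
    have it : ∀ k, u = c ^ k * u * d ^ k := by
      intro k
      induction k with
      | zero => simp
      | succ k ih =>
        calc u = c ^ k * u * d ^ k := ih
          _ = c ^ k * (c * u * d) * d ^ k := by rw [← e]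
          _ = c ^ (k + 1) * u * d ^ (k + 1) := by rw [pow_succ, pow_succ']; simp only [mul_assoc]
    constructor
    · calc c * u = c * (c ^ N * u * d ^ N) := by rw [← it]
        _ = c ^ (N + 1) * u * d ^ N := by rw [pow_succ']; simp only [mul_assoc]
        _ = u := by rw [hM, ← it]
    · calc u * d = c ^ N * u * d ^ N * d := by rw [← it]
        _ = c ^ N * u * d ^ (N + 1) := by rw [pow_succ]; simp only [mul_assoc]
        _ = u := by rw [hM, ← it]
  have h1 : a * u = u := (iter a (x * u * b) (by simpa only [mul_assoc] using h)).1
  have h2 : u * b = u := (iter (a * u * x) b (by simpa only [mul_assoc] using h)).2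
  calc u * x * u = a * u * x * (u * b) := by rw [h1, h2]
    _ = u := by simpa only [mul_assoc] using h.symm

theorem exists_absorbing_word [Finite α] (q : ℕ) :
    ∃ u : List α, ∀ x, wordType q (u ++ x ++ u) = wordType q u := by
  let F : (wordTypeCon α q).Quotient → WordType α q := fun c =>
    Quotient.lift (s := (wordTypeCon α q).toSetoid) (fun w => wordType q w.toList)
      (fun _ _ h => h) c
  have hF : Function.Injective F := by
    intro c d
    induction c using Con.induction_on
    induction d using Con.induction_on
    intro h
    exact (Con.eq _).2 h
  have : Finite (wordTypeCon α q).Quotient := Finite.of_injective F hF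
  obtain ⟨u, hu⟩ := exists_mul_mul_self_eq_self (M := (wordTypeCon α q).Quotient) (N := 2 ^ q) (by
    intro x
    induction x using Con.induction_on with
    | H v =>
      change (wordTypeCon α q).mk' v ^ _ = (wordTypeCon α q).mk' v ^ _
      rw [← map_pow, ← map_pow]
      exact (Con.eq _).2 (wordType_pow v q (by omega) (by omega)))
  induction u using Con.induction_on with
  | H u =>
    refine ⟨u.toList, fun x => ?_⟩
    have h := hu ((FreeMonoid.ofList x : FreeMonoid α) : (wordTypeCon α q).Quotient)
    rw [← Con.coe_mul, ← Con.coe_mul] at h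
    simpa [wordTypeCon] using (Con.eq _).1 h

end WordType

/-! ### Truth of sentences depends only on the type of the word of cuts -/

/-- The convex linear order on `Fin n` with the usual order, in which `m` starts a new class
if `c m = true`. -/
@[reducible]
def cutStructure {n : ℕ} (c : Fin n → Bool) : convexOrderLang.Structure (Fin n) where
  funMap f := f.elim
  RelMap r := match r with
    | .lt => fun v => v 0 < v 1
    | .eqv => fun v => ∀ m, v 0 < m ∧ m ≤ v 1 ∨ v 1 < m ∧ m ≤ v 0 → c m = false

section Definability

variable {α : Type}

/-- A property of words which depends only on the type of rank `q`. -/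
def IsTypeInvariant (q : ℕ) (P : List α → Prop) : Prop :=
  ∀ w w', wordType q w = wordType q w' → (P w ↔ P w')

namespace IsTypeInvariant

variable {q : ℕ} {P Q : List α → Prop}

theorem not (hP : IsTypeInvariant q P) : IsTypeInvariant q fun w => ¬ P w :=
  fun w w' e => not_congr (hP w w' e)

theorem and (hP : IsTypeInvariant q P) (hQ : IsTypeInvariant q Q) :
    IsTypeInvariant q fun w => P w ∧ Q w :=
  fun w w' e => and_congr (hP w w' e) (hQ w w' e)

theorem or (hP : IsTypeInvariant q P) (hQ : IsTypeInvariant q Q) :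
    IsTypeInvariant q fun w => P w ∨ Q w :=
  fun w w' e => or_congr (hP w w' e) (hQ w w' e)

theorem exists_split (hP : IsTypeInvariant q P) (R : α → Prop) :
    IsTypeInvariant (q + 1) fun w => ∃ x a y, w = x ++ a :: y ∧ P x ∧ R a := by
  have key : ∀ w w', wordType (q + 1) w = wordType (q + 1) w' →
      (∃ x a y, w = x ++ a :: y ∧ P x ∧ R a) → ∃ x a y, w' = x ++ a :: y ∧ P x ∧ R a := by
    rintro w w' h ⟨x, a, y, e, hx, ha⟩
    obtain ⟨x', y', e', h1, h2⟩ := exists_split_of_wordType_eq h e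
    exact ⟨x', a, y', e', (hP _ _ h1).1 hx, ha⟩
  exact fun w w' h => ⟨key w w' h, key w' w h.symm⟩

theorem exists_mem (R : α → Prop) : IsTypeInvariant 1 fun w => ∃ a ∈ w, R a := by
  have key : ∀ w w', wordType 1 w = wordType 1 w' → (∃ a ∈ w, R a) → ∃ a ∈ w', R a := by
    rintro w w' h ⟨a, ha, hR⟩
    obtain ⟨x, y, e⟩ := List.append_of_mem ha
    obtain ⟨x', y', rfl, -⟩ := exists_split_of_wordType_eq h e
    exact ⟨a, by simp, hR⟩
  exact fun w w' h => ⟨key w w' h, key w' w h.symm⟩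

end IsTypeInvariant

theorem ofFn_eq_append_cons {n : ℕ} (g : Fin n → α) (p : Fin n) :
    ∃ x y, List.ofFn g = x ++ g p :: y ∧ x.length = (p : ℕ) := by
  refine ⟨(List.ofFn g).take p, (List.ofFn g).drop (p + 1), ?_, by simp⟩
  have h : (p : ℕ) < (List.ofFn g).length := by simp
  conv_lhs => rw [← List.take_append_drop p (List.ofFn g), List.drop_eq_getElem_cons h]
  simp

theorem get_of_ofFn_eq_append_cons {n : ℕ} {g : Fin n → α} {x y : List α} {a : α}
    (e : List.ofFn g = x ++ a :: y) : ∃ p : Fin n, (p : ℕ) = x.length ∧ g p = a := by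
  have hl : x.length < n := by
    have := congrArg List.length e
    simp at this
    omega
  refine ⟨⟨x.length, hl⟩, rfl, ?_⟩
  have := congrArg (fun l => l[x.length]?) e
  simpa [hl] using this

theorem ofFn_split_iff {n : ℕ} (g : Fin n → α) (P : List α → Prop) (R : α → Prop) :
    (∃ x a y, List.ofFn g = x ++ a :: y ∧ P x ∧ R a) ↔
      ∃ p : Fin n, P ((List.ofFn g).take p) ∧ R (g p) := by
  constructor
  · rintro ⟨x, a, y, e, hx, ha⟩
    obtain ⟨p, hp, rfl⟩ := get_of_ofFn_eq_append_cons e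
    refine ⟨p, ?_, ha⟩
    rwa [e, hp, List.take_left]
  · rintro ⟨p, hx, ha⟩
    obtain ⟨x, y, e, hp⟩ := ofFn_eq_append_cons g p
    refine ⟨x, g p, y, e, ?_, ha⟩
    rwa [e, ← hp, List.take_left] at hx

theorem exists_mem_take_ofFn {n : ℕ} (g : Fin n → α) (R : α → Prop) (m : ℕ) :
    (∃ a ∈ (List.ofFn g).take m, R a) ↔ ∃ p : Fin n, (p : ℕ) < m ∧ R (g p) := by
  simp only [List.mem_take_iff_getElem, List.getElem_ofFn, List.length_ofFn, lt_min_iff]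
  constructor
  · rintro ⟨_, ⟨i, hi, rfl⟩, h⟩
    exact ⟨⟨i, hi.2⟩, hi.1, h⟩
  · rintro ⟨p, hp, h⟩
    exact ⟨_, ⟨p, ⟨hp, p.2⟩, rfl⟩, h⟩

end Definability

/-- The word of cuts `c`, in which each letter also records which of the points `s i` it carries. -/
def pebbleWord {n k : ℕ} (c : Fin n → Bool) (s : Fin k → Fin n) : List (Bool × (Fin k → Prop)) :=
  List.ofFn fun p => (c p, fun i => s i = p)

/-- Add a fresh pebble to a letter (or not, according to `b`). -/
def addPebble {k : ℕ} (b : Prop) (a : Bool × (Fin k → Prop)) : Bool × (Fin (k + 1) → Prop) :=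
  (a.1, Fin.snoc (α := fun _ => Prop) a.2 b)

/-- Placing a pebble relabels both sides by one fixed map and changes only the chosen letter, so
equality of the types of the sides is preserved. -/
theorem pebbleWord_snoc {n k : ℕ} {c : Fin n → Bool} {s : Fin k → Fin n} {p : Fin n}
    {x y : List (Bool × (Fin k → Prop))} {a : Bool × (Fin k → Prop)}
    (e : pebbleWord c s = x ++ a :: y) (hp : x.length = p) :
    pebbleWord c (Fin.snoc (α := fun _ => Fin n) s p) =
      x.map (addPebble False) ++ addPebble True a :: y.map (addPebble False) := by
  have hset : x.map (addPebble False) ++ addPebble True a :: y.map (addPebble False) =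
      ((pebbleWord c s).map (addPebble False)).set p (addPebble True a) := by
    rw [e, ← hp]
    simp
  have ha : a = (c p, fun i => s i = p) := by
    obtain ⟨p', hp', h⟩ := get_of_ofFn_eq_append_cons e
    rw [← h, Fin.ext (hp'.trans hp)]
  rw [hset]
  refine List.ext_getElem (by simp [pebbleWord]) fun i h1 h2 => ?_
  have hi : i < n := by simpa [pebbleWord] using h1
  rw [List.getElem_set]
  split_ifs with h
  · subst h
    simp only [pebbleWord, List.getElem_ofFn, ha, addPebble, Prod.mk.injEq, true_and]
    funext j
    refine Fin.lastCases ?_ (fun j => ?_) j <;> simp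
  · simp only [pebbleWord, List.getElem_ofFn, List.getElem_map, addPebble, Prod.mk.injEq, true_and]
    funext j
    refine Fin.lastCases ?_ (fun j => ?_) j <;> simp [Fin.ext_iff, h]

section Atomic

variable {n k : ℕ} (c : Fin n → Bool) (s : Fin k → Fin n) (i j : Fin k)

theorem pebble_eq_iff : s i = s j ↔ ∃ a ∈ pebbleWord c s, a.2 i ∧ a.2 j := by
  simp [pebbleWord, List.mem_ofFn, eq_comm]

theorem pebble_lt_iff : s i < s j ↔
    ∃ x a y, pebbleWord c s = x ++ a :: y ∧ (∃ b ∈ x, b.2 i) ∧ a.2 j := by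
  rw [pebbleWord, ofFn_split_iff]
  simp only [exists_mem_take_ofFn]
  simp

/-- Splitting at the cut, the left side consists of the positions strictly before it: it must
contain pebble `i` but not pebble `j`. Two inequalities thus become a condition of rank 2. -/
theorem exists_cut_iff : (∃ m, c m = true ∧ s i < m ∧ m ≤ s j) ↔
    ∃ x a y, pebbleWord c s = x ++ a :: y ∧ ((∃ b ∈ x, b.2 i) ∧ ¬ ∃ b ∈ x, b.2 j) ∧
      a.1 = true := by
  rw [pebbleWord, ofFn_split_iff]
  simp only [exists_mem_take_ofFn]
  simp [and_comm]

end Atomic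

theorem exists_eq_var {k : ℕ} (t : convexOrderLang.Term (Empty ⊕ Fin k)) :
    ∃ i : Fin k, t = Term.var (Sum.inr i) := by
  cases t with
  | var v =>
    rcases v with v | i
    · exact v.elim
    · exact ⟨i, rfl⟩
  | func f _ => exact f.elim

/-- Atomic formulas are read off the pebbled word at rank at most 2, and each quantifier costs one
more rank. -/
theorem exists_realize_iff_of_wordType_eq {k : ℕ} (φ : convexOrderLang.BoundedFormula Empty k) :
    ∃ q, ∀ (n n' : ℕ) (c : Fin n → Bool) (c' : Fin n' → Bool) (s : Fin k → Fin n)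
      (s' : Fin k → Fin n'), wordType q (pebbleWord c s) = wordType q (pebbleWord c' s') →
      (@BoundedFormula.Realize _ (Fin n) (cutStructure c) _ _ φ Empty.elim s ↔
        @BoundedFormula.Realize _ (Fin n') (cutStructure c') _ _ φ Empty.elim s') := by
  induction φ with
  | falsum => exact ⟨0, fun _ _ _ _ _ _ _ => Iff.rfl⟩
  | equal t₁ t₂ =>
    obtain ⟨i, rfl⟩ := exists_eq_var t₁
    obtain ⟨j, rfl⟩ := exists_eq_var t₂
    refine ⟨1, fun n n' c c' s s' h => ?_⟩
    change s i = s j ↔ s' i = s' j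
    rw [pebble_eq_iff c, pebble_eq_iff c']
    exact IsTypeInvariant.exists_mem _ _ _ h
  | @rel k m R ts =>
    choose v hv using fun l => exists_eq_var (ts l)
    obtain rfl : ts = fun l => Term.var (Sum.inr (v l)) := funext hv
    cases R with
    | lt =>
      refine ⟨2, fun n n' c c' s s' h => ?_⟩
      change s (v 0) < s (v 1) ↔ s' (v 0) < s' (v 1)
      rw [pebble_lt_iff c, pebble_lt_iff c']
      exact (IsTypeInvariant.exists_mem _).exists_split _ _ _ h
    | eqv =>
      refine ⟨2, fun n n' c c' s s' h => ?_⟩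
      have key : ∀ {n : ℕ} (c : Fin n → Bool) (s : Fin k → Fin n),
          (∀ m, s (v 0) < m ∧ m ≤ s (v 1) ∨ s (v 1) < m ∧ m ≤ s (v 0) → c m = false) ↔
          ¬ ((∃ m, c m = true ∧ s (v 0) < m ∧ m ≤ s (v 1)) ∨
            ∃ m, c m = true ∧ s (v 1) < m ∧ m ≤ s (v 0)) := by
        intro n c s
        rw [← exists_or, not_exists]
        refine forall_congr' fun m => ?_
        cases c m <;> simp
      change (∀ m, s (v 0) < m ∧ m ≤ s (v 1) ∨ s (v 1) < m ∧ m ≤ s (v 0) → c m = false) ↔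
        ∀ m, s' (v 0) < m ∧ m ≤ s' (v 1) ∨ s' (v 1) < m ∧ m ≤ s' (v 0) → c' m = false
      rw [key c s, key c' s', exists_cut_iff, exists_cut_iff, exists_cut_iff, exists_cut_iff]
      have inv : ∀ i j : Fin k, IsTypeInvariant 2 fun w : List (Bool × (Fin k → Prop)) =>
          ∃ x a y, w = x ++ a :: y ∧ ((∃ b ∈ x, b.2 i) ∧ ¬ ∃ b ∈ x, b.2 j) ∧ a.1 = true :=
        fun i j => ((IsTypeInvariant.exists_mem _).and
          (IsTypeInvariant.exists_mem _).not).exists_split _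
      exact ((inv _ _).or (inv _ _)).not _ _ h
  | imp φ ψ ihφ ihψ =>
    obtain ⟨q, hq⟩ := ihφ
    obtain ⟨r, hr⟩ := ihψ
    exact ⟨max q r, fun n n' c c' s s' h => imp_congr
      (hq n n' c c' s s' (wordType_eq_of_le (le_max_left q r) h))
      (hr n n' c c' s s' (wordType_eq_of_le (le_max_right q r) h))⟩
  | all φ ih =>
    obtain ⟨q, hq⟩ := ih
    have key : ∀ (n n' : ℕ) (c : Fin n → Bool) (c' : Fin n' → Bool) (s) (s'),
        wordType (q + 1) (pebbleWord c s) = wordType (q + 1) (pebbleWord c' s') →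
        (∀ p, @BoundedFormula.Realize _ (Fin n) (cutStructure c) _ _ φ Empty.elim
          (Fin.snoc (α := fun _ => Fin n) s p)) →
        ∀ p, @BoundedFormula.Realize _ (Fin n') (cutStructure c') _ _ φ Empty.elim
          (Fin.snoc (α := fun _ => Fin n') s' p) := by
      intro n n' c c' s s' h hn p'
      obtain ⟨x', y', e', hp'⟩ := ofFn_eq_append_cons (fun p => (c' p, fun i => s' i = p)) p'
      -- Back-and-forth: the point `p'` is answered by a letter of the first word whose two sides
      -- have the same types.
      obtain ⟨x, y, e, h1, h2⟩ := exists_split_of_wordType_eq h.symm e'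
      obtain ⟨p, hp, -⟩ := get_of_ofFn_eq_append_cons e
      refine (hq n n' c c' _ _ ?_).1 (hn p)
      rw [pebbleWord_snoc e hp.symm, pebbleWord_snoc e' hp']
      refine wordType_append (wordType_map _ h1.symm) ?_
      exact wordType_append (u := [_]) (u' := [_]) rfl (wordType_map _ h2.symm)
    exact ⟨q + 1, fun n n' c c' s s' h => ⟨key _ _ _ _ _ _ h, key _ _ _ _ _ _ h.symm⟩⟩

theorem exists_realize_sentence_iff_of_wordType_eq (φ : convexOrderLang.Sentence) :
    ∃ q, ∀ (n n' : ℕ) (c : Fin n → Bool) (c' : Fin n' → Bool),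
      wordType q (List.ofFn c) = wordType q (List.ofFn c') →
      (@Sentence.Realize _ (Fin n) (cutStructure c) φ ↔
        @Sentence.Realize _ (Fin n') (cutStructure c') φ) := by
  obtain ⟨q, hq⟩ := exists_realize_iff_of_wordType_eq φ
  refine ⟨q, fun n n' c c' h => ?_⟩
  have key : ∀ {n : ℕ} (c : Fin n → Bool),
      (@Sentence.Realize _ (Fin n) (cutStructure c) φ ↔
        @BoundedFormula.Realize _ (Fin n) (cutStructure c) _ _ φ Empty.elim Fin.elim0) ∧
      pebbleWord c Fin.elim0 = (List.ofFn c).map fun b => (b, Fin.elim0) := by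
    intro n c
    constructor
    · let := cutStructure c
      rw [Sentence.Realize, Formula.Realize, Subsingleton.elim default Empty.elim,
        Subsingleton.elim default Fin.elim0]
    · rw [pebbleWord, List.map_ofFn]
      congr 1
      funext p
      exact Prod.ext rfl (Subsingleton.elim _ _)
  rw [(key c).1, (key c').1]
  refine hq n n' c c' _ _ ?_
  rw [(key c).2, (key c').2]
  exact wordType_map _ h

/-! ### Random binary words and convergence -/

/-- The average of `f` over all binary words of length `n`. -/
noncomputable def wordAvg : ℕ → (List Bool → ℝ) → ℝ
  | 0, f => f []
  | n + 1, f => (wordAvg n (fun w => f (false :: w)) + wordAvg n fun w => f (true :: w)) / 2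

/-- Fubini: consecutive blocks of a uniformly random word are independent. -/
theorem wordAvg_append (m n : ℕ) (f : List Bool → ℝ) :
    wordAvg (m + n) f = wordAvg m fun x => wordAvg n fun y => f (x ++ y) := by
  induction m generalizing f with
  | zero => simp [wordAvg]
  | succ m ih => rw [Nat.succ_add]; simp [wordAvg, ih]

theorem wordAvg_mono {n : ℕ} {f g : List Bool → ℝ} (h : ∀ w, w.length = n → f w ≤ g w) :
    wordAvg n f ≤ wordAvg n g := by
  induction n generalizing f g with
  | zero => exact h [] rfl
  | succ n ih =>
    have h1 := ih (f := fun w => f (false :: w)) (g := fun w => g (false :: w))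
      fun w hw => h _ (by simp [hw])
    have h2 := ih (f := fun w => f (true :: w)) (g := fun w => g (true :: w))
      fun w hw => h _ (by simp [hw])
    simp only [wordAvg]
    linarith

theorem wordAvg_add (n : ℕ) (f g : List Bool → ℝ) :
    wordAvg n (fun w => f w + g w) = wordAvg n f + wordAvg n g := by
  induction n generalizing f g with
  | zero => rfl
  | succ n ih => simp only [wordAvg, ih]; ring

theorem wordAvg_mul_const (n : ℕ) (f : List Bool → ℝ) (r : ℝ) :
    wordAvg n (fun w => f w * r) = wordAvg n f * r := by
  induction n generalizing f with
  | zero => rfl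
  | succ n ih => simp only [wordAvg, ih]; ring

@[simp]
theorem wordAvg_const (n : ℕ) (r : ℝ) : wordAvg n (fun _ => r) = r := by
  induction n with
  | zero => rfl
  | succ n ih => simp [wordAvg, ih]

theorem wordAvg_sub (n : ℕ) (f g : List Bool → ℝ) :
    wordAvg n (fun w => f w - g w) = wordAvg n f - wordAvg n g := by
  have h := wordAvg_add n (fun w => f w - g w) g
  simp only [sub_add_cancel] at h
  linarith

theorem abs_wordAvg_sub_le {n : ℕ} {f g e : List Bool → ℝ}
    (h : ∀ w, w.length = n → |f w - g w| ≤ e w) : |wordAvg n f - wordAvg n g| ≤ wordAvg n e := by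
  rw [abs_le]
  constructor
  · have := wordAvg_mono (n := n) (f := fun w => g w - f w) (g := e)
      fun w hw => by linarith [(abs_le.1 (h w hw)).1]
    rw [wordAvg_sub] at this
    linarith
  · have := wordAvg_mono (n := n) (f := fun w => f w - g w) (g := e)
      fun w hw => (abs_le.1 (h w hw)).2
    rw [wordAvg_sub] at this
    linarith

theorem wordAvg_ne (u : List Bool) :
    wordAvg u.length (fun w => Set.indicator {w | w ≠ u} (fun _ => (1 : ℝ)) w) =
      1 - (1 / 2) ^ u.length := by
  induction u with
  | nil => simp [wordAvg]
  | cons b u ih =>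
    have h : ∀ b', wordAvg u.length (fun w =>
        Set.indicator {w | w ≠ b :: u} (fun _ => (1 : ℝ)) (b' :: w)) =
        if b' = b then 1 - (1 / 2) ^ u.length else 1 := by
      intro b'
      split_ifs with hb
      · subst hb
        rw [← ih]
        congr 1
        funext w
        simp [Set.indicator]
      · simp [Set.indicator, hb]
    rw [List.length_cons, wordAvg, h, h]
    cases b <;> simp [pow_succ] <;> ring

/-- The indicator of the words in which `u` does not occur. -/
noncomputable def avoids (u : List Bool) : List Bool → ℝ :=
  Set.indicator {w | ¬ u <:+: w} fun _ => 1

theorem avoids_nonneg (u w : List Bool) : 0 ≤ avoids u w :=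
  Set.indicator_nonneg (fun _ _ => zero_le_one) w

/-- A word avoiding `u` differs from `u` on each of `j` disjoint blocks of length `u.length`, and
these blocks are independent. -/
theorem wordAvg_avoids_le (u : List Bool) (j : ℕ) :
    wordAvg (u.length * j) (avoids u) ≤ (1 - (1 / 2) ^ u.length) ^ j := by
  induction j with
  | zero =>
    simp only [mul_zero, wordAvg, pow_zero, avoids]
    exact Set.indicator_le_self' (fun _ _ => zero_le_one) _
  | succ j ih =>
    have hnn : (0 : ℝ) ≤ 1 - (1 / 2) ^ u.length :=
      sub_nonneg.2 (pow_le_one₀ (by norm_num) (by norm_num))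
    rw [mul_add, mul_one, add_comm, wordAvg_append, pow_succ']
    calc _ ≤ wordAvg u.length (fun x => Set.indicator {w | w ≠ u} (fun _ => (1 : ℝ)) x *
            wordAvg (u.length * j) (avoids u)) := by
          refine wordAvg_mono fun x _ => ?_
          rw [mul_comm _ (wordAvg _ _), ← wordAvg_mul_const]
          refine wordAvg_mono fun y _ => ?_
          by_cases hx : x = u
          · have : u <:+: x ++ y := ⟨[], y, by simp [hx]⟩
            subst hx
            simp [avoids, this]
          · by_cases hy : u <:+: y
            · have : u <:+: x ++ y := hy.trans (List.suffix_append x y).isInfix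
              simp [avoids, this, hy]
            · simp only [avoids, Set.indicator, Set.mem_ofPred_eq, hy, hx, ne_eq, not_false_eq_true,
                if_true, mul_one]
              split_ifs <;> norm_num
      _ = (1 - (1 / 2) ^ u.length) * wordAvg (u.length * j) (avoids u) := by
          rw [wordAvg_mul_const, wordAvg_ne]
      _ ≤ _ := mul_le_mul_of_nonneg_left ih hnn

theorem exists_tendsto_wordAvg {q : ℕ} {P : List Bool → Prop} (hP : IsTypeInvariant q P) :
    ∃ p, Tendsto (fun n => wordAvg n (Set.indicator {w | P w} fun _ => 1)) atTop (𝓝 p) := by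
  obtain ⟨u, hu⟩ := exists_absorbing_word (α := Bool) q
  set f : List Bool → ℝ := Set.indicator {w | P w} fun _ => 1 with hf
  -- If `u` occurs in both `x` and `z`, everything between the two occurrences is absorbed, so
  -- deleting `y` changes nothing. Otherwise the right side is at least 1.
  have hfx : ∀ x y z, |f (x ++ (y ++ z)) - f (x ++ z)| ≤ avoids u x + avoids u z := by
    intro x y z
    have hle : |f (x ++ (y ++ z)) - f (x ++ z)| ≤ 1 := by
      simp only [hf, Set.indicator]
      split_ifs <;> norm_num
    by_cases hx : u <:+: x
    · by_cases hz : u <:+: z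
      · have h0 : f (x ++ (y ++ z)) = f (x ++ z) := by
          obtain ⟨a, b, rfl⟩ := hx
          obtain ⟨a', b', rfl⟩ := hz
          have key : ∀ t, wordType q (a ++ (u ++ t ++ u) ++ b') = wordType q (a ++ u ++ b') :=
            fun t => wordType_append (wordType_append rfl (hu t)) rfl
          have h := hP _ _ ((key (b ++ y ++ a')).trans (key (b ++ a')).symm)
          simp only [List.append_assoc] at h ⊢
          classical
          simp only [hf, Set.indicator_apply, Set.mem_ofPred_eq, h]
        rw [h0, sub_self, abs_zero]
        exact add_nonneg (avoids_nonneg u _) (avoids_nonneg u _)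
      · have : avoids u z = 1 := by simp [avoids, hz]
        linarith [avoids_nonneg u x]
    · have : avoids u x = 1 := by simp [avoids, hx]
      linarith [avoids_nonneg u z]
  refine cauchySeq_tendsto_of_complete (Metric.cauchySeq_iff'.2 fun ε hε => ?_)
  have hlt : (1 : ℝ) - (1 / 2) ^ u.length < 1 := sub_lt_self _ (by positivity)
  have hnn : (0 : ℝ) ≤ 1 - (1 / 2) ^ u.length :=
    sub_nonneg.2 (pow_le_one₀ (by norm_num) (by norm_num))
  obtain ⟨j, hj⟩ := exists_pow_lt_of_lt_one (half_pos hε) hlt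
  have hk := (wordAvg_avoids_le u j).trans_lt hj
  set k := u.length * j
  refine ⟨k + k, fun n hn => ?_⟩
  obtain ⟨m, rfl⟩ := Nat.exists_eq_add_of_le hn
  rw [Real.dist_eq]
  calc |wordAvg (k + k + m) f - wordAvg (k + k) f|
      ≤ wordAvg k fun x => avoids u x + wordAvg k (avoids u) := by
        rw [show k + k + m = k + (m + k) by ring, wordAvg_append, wordAvg_append k k]
        refine abs_wordAvg_sub_le fun x _ => ?_
        -- Constants are written as averages over the middle block, so that the words with and
        -- without it can be compared pointwise.
        rw [wordAvg_append, ← wordAvg_const m (wordAvg k fun y => f (x ++ y)),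
          ← wordAvg_const m (avoids u x + wordAvg k (avoids u))]
        refine abs_wordAvg_sub_le fun y _ => ?_
        rw [← wordAvg_const k (avoids u x), ← wordAvg_add]
        exact abs_wordAvg_sub_le fun z _ => hfx x y z
    _ = wordAvg k (avoids u) + wordAvg k (avoids u) := by rw [wordAvg_add, wordAvg_const]
    _ < ε := by linarith

theorem card_eq_pow_mul_wordAvg (n : ℕ) (P : List Bool → Prop) :
    (Nat.card {c : Fin n → Bool // P (List.ofFn c)} : ℝ) =
      2 ^ n * wordAvg n (Set.indicator {w | P w} fun _ => 1) := by
  classical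
  induction n generalizing P with
  | zero =>
    by_cases h : P []
    · have : Unique {c : Fin 0 → Bool // P (List.ofFn c)} :=
        ⟨⟨⟨Fin.elim0, by simpa using h⟩⟩, fun c => Subtype.ext (Subsingleton.elim _ _)⟩
      simp [wordAvg, h]
    · have : IsEmpty {c : Fin 0 → Bool // P (List.ofFn c)} := ⟨fun c => h (by simpa using c.2)⟩
      simp [wordAvg, h]
  | succ n ih =>
    let e : {c : Fin (n + 1) → Bool // P (List.ofFn c)} ≃
        {c : Fin n → Bool // P (false :: List.ofFn c)} ⊕
          {c : Fin n → Bool // P (true :: List.ofFn c)} :=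
      ((Fin.consEquiv fun _ : Fin (n + 1) => Bool).symm.subtypeEquiv
        (q := fun x => P (x.1 :: List.ofFn x.2)) fun c => by
          simp [Fin.consEquiv, Fin.tail_def]).trans <|
      { toFun := fun x => match x with
          | ⟨(false, c), h⟩ => Sum.inl ⟨c, h⟩
          | ⟨(true, c), h⟩ => Sum.inr ⟨c, h⟩
        invFun := Sum.elim (fun c => ⟨(false, c.1), c.2⟩) fun c => ⟨(true, c.1), c.2⟩
        left_inv := by rintro ⟨⟨_ | _, c⟩, h⟩ <;> rfl
        right_inv := by rintro (_ | _) <;> rfl }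
    rw [Nat.card_congr e, Nat.card_sum, Nat.cast_add, ih fun w => P (false :: w),
      ih fun w => P (true :: w), wordAvg, pow_succ]
    have h : ∀ b, (fun w => Set.indicator {w | P w} (fun _ => (1 : ℝ)) (b :: w)) =
        Set.indicator {w | P (b :: w)} fun _ => 1 := fun b => rfl
    rw [h, h]
    ring

/-! ### Rigidity and the count of labelings -/

namespace LabeledCLO

variable {n : ℕ}

theorem vec_eq_pair {M : Type*} (v : Fin 2 → M) : v = ![v 0, v 1] := by
  ext i
  fin_cases i <;> rfl

theorem Iso.lt_iff {S T : LabeledCLO n} (f : S.Iso T) (x y : Fin n) :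
    @StrLT _ T.1 (f.map x) (f.map y) ↔ @StrLT _ S.1 x y := by
  have h := @FirstOrder.Language.Equiv.map_rel' _ _ _ S.1 T.1 f 2 ConvexOrderRel.lt ![x, y]
  rw [vec_eq_pair (_ ∘ _)] at h
  exact h

theorem Iso.eqv_iff {S T : LabeledCLO n} (f : S.Iso T) (x y : Fin n) :
    @StrE _ T.1 (f.map x) (f.map y) ↔ @StrE _ S.1 x y := by
  have h := @FirstOrder.Language.Equiv.map_rel' _ _ _ S.1 T.1 f 2 ConvexOrderRel.eqv ![x, y]
  rw [vec_eq_pair (_ ∘ _)] at h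
  exact h

/-- Initial segment embeddings between well-orders are unique; rigidity therefore uses `<` alone. -/
theorem isWellOrder (S : LabeledCLO n) : IsWellOrder (Fin n) (@StrLT _ S.1) := by
  let := S.1
  have : IsTrans (Fin n) (@StrLT _ S.1) := ⟨S.2.trans⟩
  have : Std.Irrefl (@StrLT (Fin n) S.1) := ⟨S.2.irrefl⟩
  have : Std.Trichotomous (@StrLT (Fin n) S.1) := ⟨fun x y h k =>
    ((S.2.total x y).resolve_left h).resolve_right k⟩
  have : IsWellFounded (Fin n) (@StrLT _ S.1) := ⟨Finite.wellFounded_of_trans_of_irrefl _⟩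
  exact {}

/-- An isomorphism of convex linear orders is an isomorphism of the orders. -/
def Iso.toRelIso {S T : LabeledCLO n} (f : S.Iso T) : @StrLT _ S.1 ≃r @StrLT _ T.1 :=
  ⟨@FirstOrder.Language.Equiv.toEquiv _ _ _ S.1 T.1 f, fun {x y} => f.lt_iff x y⟩

theorem Iso.map_eq {S T : LabeledCLO n} (f g : S.Iso T) (x : Fin n) : f.map x = g.map x := by
  have := T.isWellOrder
  exact InitialSeg.eq f.toRelIso.toInitialSeg g.toRelIso.toInitialSeg x

/-- The isomorphism with given underlying permutation. -/
def isoOfEquiv {S T : LabeledCLO n} (e : Equiv.Perm (Fin n))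
    (hlt : ∀ x y, @StrLT _ T.1 (e x) (e y) ↔ @StrLT _ S.1 x y)
    (heqv : ∀ x y, @StrE _ T.1 (e x) (e y) ↔ @StrE _ S.1 x y) : S.Iso T :=
  @FirstOrder.Language.Equiv.mk _ _ _ S.1 T.1 e (fun f => f.elim) fun r v => by
    cases r with
    | lt => rw [vec_eq_pair v, vec_eq_pair (_ ∘ _)]; exact hlt _ _
    | eqv => rw [vec_eq_pair v, vec_eq_pair (_ ∘ _)]; exact heqv _ _

theorem ext {S T : LabeledCLO n} (hlt : ∀ x y, @StrLT _ S.1 x y ↔ @StrLT _ T.1 x y)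
    (heqv : ∀ x y, @StrE _ S.1 x y ↔ @StrE _ T.1 x y) : S = T := by
  refine Subtype.ext (FirstOrder.Language.Structure.ext ?_ ?_)
  · funext m f
    exact f.elim
  · funext m r v
    cases r with
    | lt => rw [vec_eq_pair v]; exact propext (hlt _ _)
    | eqv => rw [vec_eq_pair v]; exact propext (heqv _ _)

/-- The structure on `Fin n` with the given relations. -/
@[reducible]
def relStructure (r s : Fin n → Fin n → Prop) : convexOrderLang.Structure (Fin n) where
  funMap f := f.elim
  RelMap R := match R with
    | .lt => fun v => r (v 0) (v 1)
    | .eqv => fun v => s (v 0) (v 1)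

/-- Rename the points of a convex linear order along a permutation. -/
def permute (e : Equiv.Perm (Fin n)) (S : LabeledCLO n) : LabeledCLO n :=
  ⟨relStructure (fun x y => @StrLT _ S.1 (e.symm x) (e.symm y))
      fun x y => @StrE _ S.1 (e.symm x) (e.symm y),
    let := S.1
    @IsConvexLinearOrder.mk _ (_) (fun _ => S.2.irrefl _) (fun _ _ _ => S.2.trans _ _ _)
      (fun _ _ => (S.2.total _ _).imp_right (Or.imp_left fun h => e.symm.injective h))
      ⟨fun _ => S.2.equivalence.refl _, fun h => S.2.equivalence.symm h,
        fun h k => S.2.equivalence.trans h k⟩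
      fun _ _ _ => S.2.convex _ _ _⟩

/-- Renaming points is an isomorphism. -/
def permuteIso (e : Equiv.Perm (Fin n)) (S : LabeledCLO n) : S.Iso (permute e S) :=
  isoOfEquiv e
    (fun x y => by
      change @StrLT _ S.1 (e.symm (e x)) (e.symm (e y)) ↔ _
      simp)
    fun x y => by
      change @StrE _ S.1 (e.symm (e x)) (e.symm (e y)) ↔ _
      simp

theorem permuteIso_map (e : Equiv.Perm (Fin n)) (S : LabeledCLO n) (x : Fin n) :
    (permuteIso e S).map x = e x := rfl

theorem exists_permute_eq {S T : LabeledCLO n} (f : S.Iso T) : ∃ e, permute e S = T := by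
  let e : Equiv.Perm (Fin n) := @FirstOrder.Language.Equiv.toEquiv _ _ _ S.1 T.1 f
  have he : ∀ x, f.map (e.symm x) = x := fun x => e.apply_symm_apply x
  refine ⟨e, ext (fun x y => ?_) fun x y => ?_⟩
  · rw [← he x, ← he y, f.lt_iff, he, he]
    rfl
  · rw [← he x, ← he y, f.eqv_iff, he, he]
    rfl

/-- A labeled convex linear order is an isomorphism class together with a labelling. -/
noncomputable def permProdUnlabeledEquiv (n : ℕ) :
    Equiv.Perm (Fin n) × UnlabeledCLO n ≃ LabeledCLO n :=
  Equiv.ofBijective (fun p => permute p.1 (Quotient.out p.2)) <| by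
    constructor
    · rintro ⟨σ, C⟩ ⟨τ, D⟩ (h : permute σ (Quotient.out C) = permute τ (Quotient.out D))
      obtain rfl : C = D := by
        rw [← Quotient.out_eq C, ← Quotient.out_eq D]
        have h1 : Quotient.out C ≈ permute σ (Quotient.out C) := ⟨permuteIso σ _⟩
        have h2 : Quotient.out D ≈ permute τ (Quotient.out D) := ⟨permuteIso τ _⟩
        exact Quotient.sound (Setoid.trans h1 (h ▸ Setoid.symm h2))
      -- Stated for a variable target so that `h` can be substituted: `σ` and `τ` then underlie
      -- isomorphisms with the same source and target, hence agree.
      have key : ∀ T, T = permute σ (Quotient.out C) →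
          ∃ f : LabeledCLO.Iso (Quotient.out C) T, ∀ x, f.map x = σ x := by
        rintro _ rfl
        exact ⟨permuteIso σ _, permuteIso_map σ _⟩
      obtain ⟨f, hf⟩ := key _ h.symm
      obtain rfl : σ = τ := Equiv.ext fun x =>
        (hf x).symm.trans ((f.map_eq (permuteIso τ _) x).trans (permuteIso_map τ _ x))
      rfl
    · intro T
      obtain ⟨f⟩ : Quotient.out (⟦T⟧ : UnlabeledCLO n) ≈ T := Quotient.exact (Quotient.out_eq _)
      obtain ⟨e, he⟩ := exists_permute_eq f
      exact ⟨(e, ⟦T⟧), he⟩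

theorem sat_permProdUnlabeledEquiv (φ : convexOrderLang.Sentence)
    (p : Equiv.Perm (Fin n) × UnlabeledCLO n) :
    (permProdUnlabeledEquiv n p).Sat φ ↔ p.2.Sat φ := by
  have h : UnlabeledCLO.Sat (⟦Quotient.out p.2⟧ : UnlabeledCLO n) φ ↔ p.2.Sat φ :=
    iff_of_eq (congrArg (fun C : UnlabeledCLO n => C.Sat φ) (Quotient.out_eq p.2))
  exact (sat_of_iso (permuteIso p.1 (Quotient.out p.2)) φ).symm.trans h

end LabeledCLO

/-- Numerator and denominator both acquire the factor `n!`, the number of labelings of each class.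
-/
theorem labeledProb_eq_unlabeledProb (φ : convexOrderLang.Sentence) (n : ℕ) :
    labeledProb φ n = unlabeledProb φ n := by
  have h1 : Nat.card (LabeledCLO n) = Nat.card (Equiv.Perm (Fin n)) * Nat.card (UnlabeledCLO n) := by
    rw [← Nat.card_prod, Nat.card_congr (LabeledCLO.permProdUnlabeledEquiv n)]
  have h2 : Nat.card {S : LabeledCLO n // S.Sat φ} =
      Nat.card (Equiv.Perm (Fin n)) * Nat.card {C : UnlabeledCLO n // C.Sat φ} := by
    rw [mul_comm, ← Nat.card_prod]
    exact Nat.card_congr ((((Equiv.prodComm _ _).trans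
      (LabeledCLO.permProdUnlabeledEquiv n)).subtypeEquiv fun p =>
        (LabeledCLO.sat_permProdUnlabeledEquiv φ (p.2, p.1)).symm).symm.trans
          (Equiv.prodSubtypeFstEquivSubtypeProd (p := fun C : UnlabeledCLO n => C.Sat φ)))
  rw [labeledProb, unlabeledProb, h1, h2, Nat.cast_mul, Nat.cast_mul]
  exact mul_div_mul_left _ _ (Nat.cast_ne_zero.2 Nat.card_pos.ne')

/-! ### Coding convex linear orders by cuts -/

/-- The convex linear order on `Fin n` with cuts `c`. -/
def cutCLO {n : ℕ} (c : Fin n → Bool) : LabeledCLO n :=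
  ⟨cutStructure c, @IsConvexLinearOrder.mk _ (cutStructure c)
    (fun x => lt_irrefl x)
    (fun x y z (h : x < y) (k : y < z) => lt_trans h k)
    (fun x y => lt_trichotomy x y)
    ⟨fun x m hm => absurd hm (by simp),
      fun {x y} h m hm => h m hm.symm,
      fun {x y z} h k m hm => by
        have h' := h m
        have k' := k m
        change x < m ∧ m ≤ z ∨ z < m ∧ m ≤ x at hm
        change x < m ∧ m ≤ y ∨ y < m ∧ m ≤ x → _ at h'
        change y < m ∧ m ≤ z ∨ z < m ∧ m ≤ y → _ at k'
        grind⟩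
    fun x y z h (k : x < z) (l : z < y) m hm => h m <| by
      change x < m ∧ m ≤ z ∨ z < m ∧ m ≤ x at hm
      change x < m ∧ m ≤ y ∨ y < m ∧ m ≤ x
      omega⟩

theorem cutCLO_lt {n : ℕ} (c : Fin n → Bool) (x y : Fin n) :
    @StrLT _ (cutCLO c).1 x y ↔ x < y := Iff.rfl

theorem cutCLO_eqv {n : ℕ} (c : Fin n → Bool) (x y : Fin n) :
    @StrE _ (cutCLO c).1 x y ↔ ∀ m, x < m ∧ m ≤ y ∨ y < m ∧ m ≤ x → c m = false := Iff.rfl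

/-- A convex equivalence is determined by its adjacent pairs: convexity passes from a pair to the
adjacent pairs between, and transitivity goes back along the chain. -/
theorem eqv_iff_forall_succ {m : ℕ} {r : Fin (m + 1) → Fin (m + 1) → Prop} (hr : Equivalence r)
    (hc : ∀ x y z, r x y → x < z → z < y → r x z) (x y : Fin (m + 1)) :
    r x y ↔ ∀ i : Fin m, x < i.succ ∧ i.succ ≤ y ∨ y < i.succ ∧ i.succ ≤ x →
      r i.castSucc i.succ := by
  have hc' : ∀ x y z, r x y → x ≤ z → z ≤ y → r x z := by
    intro x y z h h1 h2
    rcases h1.eq_or_lt with rfl | h1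
    · exact hr.refl _
    · rcases h2.eq_or_lt with rfl | h2
      · exact h
      · exact hc x y z h h1 h2
  have key : ∀ x y, r x y → ∀ i : Fin m, x < i.succ → i.succ ≤ y → r i.castSucc i.succ := by
    intro x y h i h1 h2
    have h3 : x ≤ i.castSucc := Fin.le_castSucc_iff.2 h1
    exact hr.trans (hr.symm (hc' x y _ h h3 ((Fin.castSucc_lt_succ).le.trans h2)))
      (hc' x y _ h h1.le h2)
  have key' : ∀ x y, (∀ i : Fin m, x < i.succ → i.succ ≤ y → r i.castSucc i.succ) →
      x ≤ y → r x y := by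
    intro x y
    induction y using Fin.induction with
    | zero =>
      intro _ h
      rw [Fin.le_zero_iff.1 h]
      exact hr.refl _
    | succ i ih =>
      intro h hle
      rcases hle.eq_or_lt with rfl | hlt
      · exact hr.refl _
      · exact hr.trans (ih (fun j h1 h2 => h j h1 (h2.trans (Fin.castSucc_lt_succ).le))
          (Fin.le_castSucc_iff.2 hlt)) (h i hlt le_rfl)
  constructor
  · rintro h i (⟨h1, h2⟩ | ⟨h1, h2⟩)
    · exact key x y h i h1 h2
    · exact key y x (hr.symm h) i h1 h2
  · intro h
    rcases le_total x y with hxy | hxy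
    · exact key' x y (fun i h1 h2 => h i (Or.inl ⟨h1, h2⟩)) hxy
    · exact hr.symm (key' y x (fun i h1 h2 => h i (Or.inr ⟨h1, h2⟩)) hxy)

theorem exists_equiv_fin_lt_iff {M : Type*} [Fintype M] {n : ℕ} (h : Fintype.card M = n)
    (r : M → M → Prop) [IsStrictTotalOrder M r] : ∃ e : M ≃ Fin n, ∀ x y, e x < e y ↔ r x y := by
  classical
  let := linearOrderOfSTO r
  exact ⟨(Fintype.orderIsoFinOfCardEq M h).symm.toEquiv,
    fun x y => (Fintype.orderIsoFinOfCardEq M h).symm.lt_iff_lt⟩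

theorem exists_perm_lt_iff {n : ℕ} (S : LabeledCLO n) :
    ∃ e : Equiv.Perm (Fin n), ∀ x y, e x < e y ↔ @StrLT _ S.1 x y := by
  have := S.isWellOrder
  exact exists_equiv_fin_lt_iff (Fintype.card_fin n) _

theorem exists_iso_cutCLO {m : ℕ} (S : LabeledCLO (m + 1)) :
    ∃ d : Fin m → Bool, Nonempty (S.Iso (cutCLO (Fin.cons true d : Fin (m + 1) → Bool))) := by
  classical
  let := S.1
  obtain ⟨e, he⟩ := exists_perm_lt_iff S
  let r : Fin (m + 1) → Fin (m + 1) → Prop := fun x y => @StrE _ S.1 (e.symm x) (e.symm y)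
  have hr : Equivalence r := ⟨fun _ => S.2.equivalence.refl _, fun h => S.2.equivalence.symm h,
    fun h k => S.2.equivalence.trans h k⟩
  have hc : ∀ x y z, r x y → x < z → z < y → r x z := fun x y z h h1 h2 =>
    S.2.convex _ _ _ h ((he _ _).1 (by simpa using h1)) ((he _ _).1 (by simpa using h2))
  refine ⟨fun i => decide (¬ r i.castSucc i.succ), ⟨LabeledCLO.isoOfEquiv e
    (fun x y => (cutCLO_lt _ _ _).trans (he x y)) fun x y => ?_⟩⟩
  -- The cut at the first point is split off: no point lies below it, so its condition is vacuous.
  rw [cutCLO_eqv, Fin.forall_fin_succ]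
  have h := eqv_iff_forall_succ hr hc (e x) (e y)
  simp only [r, Equiv.symm_apply_apply] at h
  rw [h]
  simp [r]

theorem eq_of_iso_cutCLO {m : ℕ} {d d' : Fin m → Bool}
    (f : (cutCLO (Fin.cons true d : Fin (m + 1) → Bool)).Iso (cutCLO (Fin.cons true d'))) :
    d = d' := by
  -- Both structures carry the usual order of `Fin (m + 1)`, so `f` is the identity and the classes
  -- can be compared directly.
  have hf : ∀ x, f.map x = x := by
    intro x
    have := (cutCLO (Fin.cons true d : Fin (m + 1) → Bool)).isWellOrder
    have : IsWellOrder (Fin (m + 1)) (@StrLT _ (cutCLO (Fin.cons true d')).1) :=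
      (cutCLO (Fin.cons true d' : Fin (m + 1) → Bool)).isWellOrder
    exact InitialSeg.eq f.toRelIso.toInitialSeg (InitialSeg.refl _) x
  funext i
  have h := f.eqv_iff i.castSucc i.succ
  rw [hf, hf, cutCLO_eqv, cutCLO_eqv] at h
  have key : ∀ d : Fin m → Bool, (∀ j : Fin (m + 1), i.castSucc < j ∧ j ≤ i.succ ∨
      i.succ < j ∧ j ≤ i.castSucc → (Fin.cons true d : Fin (m + 1) → Bool) j = false) ↔
      d i = false := by
    intro d
    constructor
    · intro h
      simpa using h i.succ (Or.inl ⟨Fin.castSucc_lt_succ, le_rfl⟩)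
    · intro h j hj
      obtain rfl : j = i.succ := by
        simp only [Fin.lt_def, Fin.le_def, Fin.val_castSucc, Fin.val_succ] at hj
        ext
        simp
        omega
      simpa using h
  rw [key, key] at h
  cases hd : d i <;> cases hd' : d' i <;> simp_all

/-- A convex linear order on `m + 1` points is given by the set of points other than the first which
start a new class. -/
noncomputable def cutsEquiv (m : ℕ) : (Fin m → Bool) ≃ UnlabeledCLO (m + 1) :=
  Equiv.ofBijective (fun d => ⟦cutCLO (Fin.cons true d)⟧) <| by
    constructor
    · intro d d' h
      obtain ⟨f⟩ : cutCLO (Fin.cons true d : Fin (m + 1) → Bool) ≈ cutCLO (Fin.cons true d') :=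
        Quotient.exact h
      exact eq_of_iso_cutCLO f
    · intro C
      induction C using Quotient.inductionOn with
      | h S =>
        obtain ⟨d, ⟨f⟩⟩ := exists_iso_cutCLO S
        exact ⟨d, Quotient.sound (Setoid.symm ⟨f⟩)⟩

/-! ### The limit law -/

theorem exists_tendsto_unlabeledProb (φ : convexOrderLang.Sentence) :
    ∃ p, Tendsto (unlabeledProb φ) atTop (𝓝 p) := by
  obtain ⟨q, hq⟩ := exists_realize_sentence_iff_of_wordType_eq φ
  -- The prefixed `true` marks the first point, so a word of length `m` codes an order on `m + 1`
  -- points.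
  let P : List Bool → Prop := fun w => @Sentence.Realize _ _ (cutStructure (true :: w).get) φ
  have hP : IsTypeInvariant q P := fun w w' h => hq _ _ _ _ <| by
    rw [List.ofFn_get, List.ofFn_get]
    exact wordType_append (u := [true]) (u' := [true]) rfl h
  obtain ⟨p, hp⟩ := exists_tendsto_wordAvg hP
  refine ⟨p, (tendsto_add_atTop_iff_nat 1).1 (hp.congr fun m => ?_)⟩
  have h1 : Nat.card (UnlabeledCLO (m + 1)) = 2 ^ m := by
    rw [← Nat.card_congr (cutsEquiv m)]
    simp
  have h2 : Nat.card {C : UnlabeledCLO (m + 1) // C.Sat φ} =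
      Nat.card {d : Fin m → Bool // P (List.ofFn d)} := by
    refine Nat.card_congr ((cutsEquiv m).subtypeEquiv fun d => ?_).symm
    -- The two cut functions list the same word but have domains `Fin (m + 1)` and `Fin` of a list
    -- length; type invariance bridges them without casts.
    refine hq _ _ _ _ ?_
    rw [List.ofFn_get]
    simp [List.ofFn_succ]
  rw [unlabeledProb, h1, h2, card_eq_pow_mul_wordAvg, Nat.cast_pow, Nat.cast_ofNat,
    mul_div_cancel_left₀ _ (by positivity)]

theorem theorem3 :
    -- finite convex linear orders have no nontrivial automorphisms
    (∀ (n : ℕ) (S : LabeledCLO n) (f : S.Iso S) (x : Fin n), LabeledCLO.Iso.map f x = x) ∧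
    -- the labeled and unlabeled probabilities coincide
    (∀ (φ : convexOrderLang.Sentence) (n : ℕ), labeledProb φ n = unlabeledProb φ n) ∧
    -- labeled and unlabeled limit laws
    (∀ φ : convexOrderLang.Sentence, ∃ p : ℝ,
      Tendsto (labeledProb φ) atTop (𝓝 p) ∧ Tendsto (unlabeledProb φ) atTop (𝓝 p)) := by
  refine ⟨fun n S f x => ?_, labeledProb_eq_unlabeledProb, fun φ => ?_⟩
  · exact f.map_eq (LabeledCLO.isoOfEquiv (Equiv.refl _) (fun _ _ => Iff.rfl) fun _ _ => Iff.rfl) x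
  · obtain ⟨p, hp⟩ := exists_tendsto_unlabeledProb φ
    exact ⟨p, hp.congr fun n => (labeledProb_eq_unlabeledProb φ n).symm, hp⟩
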